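/- **Theorem D (Random pointwise $\ell$-averaging theorem).** Let $\ell$ be a positive integer, let $(u_n)$ be a sequence of probabilities that is non-increasing for $n\ge 1$, $u_1\ge u_2\ge\dots$, and let $(U_n)$ be independent $0$-$1$ valued random variables on a probability space $(\Omega,P)$ with $P(U_n=1)=u_n=1-P(U_n=0)$. Suppose that for some $\delta>0$ $$u_n\cdot\frac{n^{1/(\ell+1)}}{\log^{2+\delta}n}\to\infty\qquad(n\to\infty).$$ Then there is a set $\Omega'\subset\Omega$ with $P(\Omega')=1$ such that for every $\omega\in\Omega'$ the following holds: for every probability space $(X,\mu)$ with a measurable, measure preserving transformation $T:X\to X$, and for all bounded measurable (real or complex valued) functions $F_1,\dots,F_\ell$ on $X$, $$\lim_{N\to\infty}\frac{1}{\sum_{n<N}U_n(\omega)}\sum_{n<N}\bigl(U_n(\omega)-u_n\bigr)\,F_1(T^nx)\,F_2(T^{2n}x)\cdots F_\ell(T^{\ell n}x)=0\qquad\text{for $\mu$-a.e. }x\in X.$$ Here $\sum_{n<N}$ means $\sum_{0\le n<N}$, and $u_0\in[0,1]$ is arbitrary (for instance $0$, which makes the sums start at $n=1$). -/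

import Mathlib

open MeasureTheory ProbabilityTheory Filter Topology

/-- `U 0, U 1, U 2, …` are independent `0-1` valued random variables on the probability space
`(Ω, P)` with `P(U n = 1) = u n`. If `P` is a probability measure then necessarily
`0 ≤ u n ≤ 1` and `P(U n = 0) = 1 - u n`. -/
structure IsRandomIndicator {Ω : Type*} [MeasurableSpace Ω] (P : Measure Ω)
    (u : ℕ → ℝ) (U : ℕ → Ω → ℝ) : Prop where
  measurable : ∀ n, Measurable (U n)
  zero_or_one : ∀ n ω, U n ω = 0 ∨ U n ω = 1
  indep : iIndepFun U P
  law : ∀ n, P.real {ω | U n ω = 1} = u n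

/-- The product `T^n F₁(x) · T^{2n} F₂(x) ⋯ T^{ℓn} F_ℓ(x)`, where `T^k F (x) = F (T^k x)`.
The function `F_i` of the mathematical text, `1 ≤ i ≤ ℓ`, is `F j` with `(j : ℕ) + 1 = i`. -/
def multipleProduct {X : Type*} (T : X → X) {ℓ : ℕ} (F : Fin ℓ → X → ℂ) (n : ℕ) (x : X) : ℂ :=
  ∏ j : Fin ℓ, F j (T^[((j : ℕ) + 1) * n] x)

/-- The average
`(1 / ∑_{n<N} a n) ∑_{n<N} (a n - u n) · T^n F₁(x) · T^{2n} F₂(x) ⋯ T^{ℓn} F_ℓ(x)`,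
to be used with `a n = U n ω`. -/
noncomputable def differenceAverage {X : Type*} (T : X → X) {ℓ : ℕ} (F : Fin ℓ → X → ℂ)
    (a u : ℕ → ℝ) (N : ℕ) (x : X) : ℂ :=
  (∑ n ∈ Finset.range N, a n)⁻¹ •
    ∑ n ∈ Finset.range N, (a n - u n) • multipleProduct T F n x

/-! Put `w N = ∑_{n<N} u n` and let `D N` be the unnormalized weighted sum. Its conjugate, scaled to
modulus at most one, serves as an extra function `F₀`, so that `∫ ‖D N‖²` becomes an integral of
products of `ℓ + 1` functions at `x, Tⁿx, …, T^{ℓn}x`. Invariance of the measure lets the starting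
point be moved by any `h n`, separately for each `n`. It thus suffices to bound `∑ (U n - u n) ∏ j,
f j (h n + j n)` uniformly over sequences `f j` of modulus at most one. No dynamical system occurs
in this bound, so one null set of `ω` serves all systems.

With `q` of order `N^{1/(ℓ+1)}`, `exists_digit_separation` chooses `h` so that the `j`-th factor
ignores one of the `ℓ + 1` base-`q` digits of `n`. Only `(ℓ+1) q^ℓ` values of the `f j` then matter,
and by convexity each may be taken among four vertices. This leaves `exp(O(N^{ℓ/(ℓ+1)}))` choices.
Each fails with probability at most `4 exp(-c t² w(N))`, and the growth hypothesis makes `t² w(N)`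
dominate `N^{ℓ/(ℓ+1)}` for `t = logRate δ N`. Borel–Cantelli gives `ae_eventually_exists_shift`.

Hence eventually `∫ (‖D N‖ / w N)² ≤ 6 t`, which is summable along `N = ⌈b^k⌉`. This gives almost
everywhere convergence along these `N`; monotonicity of `u` fills the gaps as `b` decreases to 1. -/

namespace IsRandomIndicator

variable {Ω : Type*} [MeasurableSpace Ω] {P : Measure Ω}
  {u : ℕ → ℝ} {U : ℕ → Ω → ℝ}

/-! ### Exponential tail bounds for real weights -/

lemma prob_nonneg (hU : IsRandomIndicator P u U) (n : ℕ) : 0 ≤ u n := by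
  rw [← hU.law n]; exact measureReal_nonneg

lemma prob_le_one [IsProbabilityMeasure P] (hU : IsRandomIndicator P u U) (n : ℕ) : u n ≤ 1 := by
  rw [← hU.law n]; exact measureReal_le_one

lemma nonneg (hU : IsRandomIndicator P u U) (n : ℕ) (ω : Ω) : 0 ≤ U n ω := by
  rcases hU.zero_or_one n ω with h | h <;> simp [h]

lemma le_one (hU : IsRandomIndicator P u U) (n : ℕ) (ω : Ω) : U n ω ≤ 1 := by
  rcases hU.zero_or_one n ω with h | h <;> simp [h]

lemma integrable [IsProbabilityMeasure P] (hU : IsRandomIndicator P u U) (n : ℕ) :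
    Integrable (U n) P :=
  Integrable.of_bound (hU.measurable n).aestronglyMeasurable 1
    (ae_of_all _ fun ω => by
      rw [Real.norm_eq_abs, abs_of_nonneg (hU.nonneg n ω)]; exact hU.le_one n ω)

lemma integral_eq (hU : IsRandomIndicator P u U) (n : ℕ) : ∫ ω, U n ω ∂P = u n := by
  have hm : MeasurableSet {ω | U n ω = 1} := hU.measurable n (measurableSet_singleton 1)
  have h : U n = {ω | U n ω = 1}.indicator 1 := by
    ext ω
    rcases hU.zero_or_one n ω with h | h <;> simp [Set.indicator, h]
  rw [← hU.law n, ← integral_indicator_one hm, ← h]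

/-- As `U n` is `0`-`1` valued, the exponential is affine in it; then `1 + y ≤ exp y` and `exp x - 1
- x ≤ x²` for `|x| ≤ 1`. -/
lemma mgf_centered_le [IsProbabilityMeasure P] (hU : IsRandomIndicator P u U) (n : ℕ) {x : ℝ}
    (hx : |x| ≤ 1) :
    ∫ ω, Real.exp (x * (U n ω - u n)) ∂P ≤ Real.exp (u n * x ^ 2) := by
  have h : ∀ ω, Real.exp (x * (U n ω - u n)) =
      Real.exp (-(x * u n)) * (1 + (Real.exp x - 1) * U n ω) := by
    intro ω
    rcases hU.zero_or_one n ω with h | h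
    · simp [h]
    · rw [h, mul_one, add_sub_cancel, ← Real.exp_add]; ring_nf
  simp_rw [h]
  rw [integral_const_mul, integral_add (integrable_const _) ((hU.integrable n).const_mul _),
    integral_const_mul, hU.integral_eq]
  simp only [integral_const, probReal_univ, smul_eq_mul, mul_one]
  have h1 := (abs_le.1 (Real.abs_exp_sub_one_sub_id_le hx)).2
  have h2 := Real.add_one_le_exp ((Real.exp x - 1) * u n)
  calc _ ≤ Real.exp (-(x * u n)) * Real.exp ((Real.exp x - 1) * u n) := by gcongr; linarith
    _ = Real.exp (u n * (Real.exp x - 1 - x)) := by rw [← Real.exp_add]; ring_nf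
    _ ≤ _ := by gcongr; exact hU.prob_nonneg n

/-- Chernoff's method. The exponent `-c t w + c² A² w` is minimal at `c = t / (2A²)`, and `t ≤ 2A`
gives `c A ≤ 1`, as the bound on the moment generating function requires. -/
lemma measure_sum_ge_le [IsProbabilityMeasure P] (hU : IsRandomIndicator P u U) (N : ℕ) (a : ℕ → ℝ)
    {A t : ℝ} (hA : 0 < A) (ha : ∀ n, |a n| ≤ A) (ht : 0 ≤ t) (htA : t ≤ 2 * A) :
    P.real {ω | t * ∑ n ∈ Finset.range N, u n ≤ ∑ n ∈ Finset.range N, a n * (U n ω - u n)} ≤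
      Real.exp (-(t ^ 2 * (∑ n ∈ Finset.range N, u n) / (4 * A ^ 2))) := by
  set w := ∑ n ∈ Finset.range N, u n with hw
  set c := t / (2 * A ^ 2) with hc
  have hc0 : 0 ≤ c := by positivity
  have hcA : c * A ≤ 1 := by
    rw [hc]; field_simp; linarith
  let Y : ℕ → Ω → ℝ := fun n ω => a n * (U n ω - u n)
  have hYm : ∀ n, Measurable (Y n) := fun n => ((hU.measurable n).sub_const _).const_mul _
  have hYi : iIndepFun Y P :=
    hU.indep.comp (fun n y => a n * (y - u n)) (fun n => by fun_prop)
  have hUb : ∀ n ω, |U n ω - u n| ≤ 1 := fun n ω => abs_le.2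
    ⟨by linarith [hU.nonneg n ω, hU.prob_le_one n], by linarith [hU.le_one n ω, hU.prob_nonneg n]⟩
  have hsum : ∀ ω, (∑ n ∈ Finset.range N, Y n) ω =
      ∑ n ∈ Finset.range N, a n * (U n ω - u n) := fun ω => by simp [Y]
  have hint : Integrable (fun ω => Real.exp (c * (∑ n ∈ Finset.range N, Y n) ω)) P := by
    refine Integrable.of_bound (C := Real.exp (c * (N * A))) ?_ (ae_of_all _ fun ω => ?_)
    · refine Measurable.aestronglyMeasurable ?_
      have := Finset.measurable_sum (Finset.range N) (fun n _ => hYm n)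
      fun_prop
    · rw [Real.norm_eq_abs, Real.abs_exp, hsum]
      gcongr
      calc _ ≤ ∑ n ∈ Finset.range N, A := Finset.sum_le_sum fun n _ => ?_
        _ = _ := by simp
      calc a n * (U n ω - u n) ≤ |a n * (U n ω - u n)| := le_abs_self _
        _ = |a n| * |U n ω - u n| := abs_mul _ _
        _ ≤ A * 1 := mul_le_mul (ha n) (hUb n ω) (abs_nonneg _) hA.le
        _ = A := mul_one A
  have h := measure_ge_le_exp_mul_mgf (μ := P) (X := ∑ n ∈ Finset.range N, Y n) (t * w) hc0 hint
  simp_rw [hsum] at h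
  refine h.trans ?_
  rw [hYi.mgf_sum hYm]
  have hprod : ∏ n ∈ Finset.range N, mgf (Y n) P c ≤ Real.exp (c ^ 2 * A ^ 2 * w) := by
    calc _ ≤ ∏ n ∈ Finset.range N, Real.exp (u n * (c * A) ^ 2) :=
          Finset.prod_le_prod (fun n _ => mgf_nonneg) fun n _ => ?_
      _ = _ := by rw [← Real.exp_sum, hw, ← Finset.sum_mul]; ring_nf
    have hx : |c * a n| ≤ c * A := by
      rw [abs_mul, abs_of_nonneg hc0]; exact mul_le_mul_of_nonneg_left (ha n) hc0
    have h1 := hU.mgf_centered_le n (hx.trans hcA)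
    have h2 : mgf (Y n) P c = ∫ ω, Real.exp (c * a n * (U n ω - u n)) ∂P := by
      simp only [mgf, Y, mul_assoc]
    rw [h2]
    refine h1.trans ?_
    exact Real.exp_le_exp.2 (mul_le_mul_of_nonneg_left
      (sq_le_sq' (by linarith [(abs_le.1 hx).1]) (abs_le.1 hx).2) (hU.prob_nonneg n))
  calc _ ≤ Real.exp (-c * (t * w)) * Real.exp (c ^ 2 * A ^ 2 * w) := by gcongr
    _ = _ := by
      rw [← Real.exp_add]
      congr 1
      rw [hc]; field_simp; ring

end IsRandomIndicator

/-! ### Separation of digits -/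

/-- Writing `n = ∑ i, d i * q ^ i` in base `q`, the progression with step `n` that starts at
`∑ i, i * (q - d i) * q ^ i` has a `j`-th term which does not depend on the digit `d j`. -/
lemma exists_digit_separation (ℓ q : ℕ) (hq : 0 < q) :
    ∃ (h : ℕ → ℕ) (κ : Fin (ℓ + 1) → ℕ → Fin ℓ → Fin q)
      (E : Fin (ℓ + 1) → (Fin ℓ → Fin q) → ℕ),
      ∀ n < q ^ (ℓ + 1), ∀ j : Fin (ℓ + 1), h n + (j : ℕ) * n = E j (κ j n) := by
  have hpos : 0 < q ^ (ℓ + 1) := by positivity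
  let d : ℕ → Fin (ℓ + 1) → Fin q := fun n =>
    finFunctionFinEquiv.symm ⟨n % q ^ (ℓ + 1), Nat.mod_lt _ hpos⟩
  refine ⟨fun n => ∑ i : Fin (ℓ + 1), (i : ℕ) * (q - d n i) * q ^ (i : ℕ),
    fun j n i => d n (j.succAbove i),
    fun j k => j * q * q ^ (j : ℕ) + ∑ i : Fin ℓ, ((j.succAbove i : ℕ) * (q - k i) + j * k i) *
      q ^ (j.succAbove i : ℕ), fun n hn j => ?_⟩
  have hd : ∑ i, (d n i : ℕ) * q ^ (i : ℕ) = n := by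
    rw [← finFunctionFinEquiv_apply]
    simp [d, Nat.mod_eq_of_lt hn]
  -- In `h n + j n` the digit `d i` has coefficient `(j - i) q^i`, which vanishes at `i = j`.
  have hj : (j : ℕ) * (q - d n j) + j * d n j = j * q := by
    rw [← mul_add, Nat.sub_add_cancel (d n j).isLt.le]
  have hjn : (j : ℕ) * n = ∑ i, (j : ℕ) * ((d n i : ℕ) * q ^ (i : ℕ)) := by
    rw [← Finset.mul_sum, hd]
  rw [hjn, ← Finset.sum_add_distrib, Fin.sum_univ_succAbove _ j]
  congr 1
  · rw [← hj]; ring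
  · exact Finset.sum_congr rfl fun i _ => by ring

/-! ### Reduction from the unit disc to finitely many vertices -/

/-- Coordinates are pushed to vertices one at a time, never decreasing `Φ`; joint convexity, which a
product of coordinates lacks, is not needed. -/
lemma le_of_forall_vertices_le {I : Type*} [Fintype I] [DecidableEq I] {V : Set ℂ}
    {Φ : (I → ℂ) → ℝ} (hΦ : ∀ g i, ConvexOn ℝ Set.univ fun z => Φ (Function.update g i z)) {B : ℝ}
    (hB : ∀ g : I → ℂ, (∀ i, g i ∈ V) → Φ g ≤ B) (g : I → ℂ)
    (hg : ∀ i, g i ∈ convexHull ℝ V) : Φ g ≤ B := by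
  -- `s` contains the coordinates that may still lie off the vertices.
  have key : ∀ s : Finset I, ∀ g : I → ℂ, (∀ i, g i ∈ convexHull ℝ V) → (∀ i ∉ s, g i ∈ V) →
      Φ g ≤ B := by
    intro s
    induction s using Finset.induction_on with
    | empty => exact fun g _ hg => hB g fun i => hg i (Finset.notMem_empty i)
    | insert a s _ ih =>
      intro g hg hgV
      obtain ⟨v, hv, hle⟩ := ((hΦ g a).subset (Set.subset_univ _)
        (convex_convexHull ℝ V)).exists_ge_of_mem_convexHull (subset_convexHull ℝ V) (hg a)
      rw [Function.update_eq_self] at hle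
      refine hle.trans (ih _ (fun i => ?_) fun i hi => ?_)
      · rcases eq_or_ne i a with rfl | h
        · simpa using subset_convexHull ℝ V hv
        · simpa [h] using hg i
      · rcases eq_or_ne i a with rfl | h
        · simpa using hv
        · simpa [h] using hgV i (by simp [h, hi])
  exact key Finset.univ g hg (by simp)

/-- The vertices `±1 ± i` of a square that contains the unit disc. -/
noncomputable def squareVertices : Finset ℂ := {⟨1, 1⟩, ⟨1, -1⟩, ⟨-1, 1⟩, ⟨-1, -1⟩}

lemma card_squareVertices_le : squareVertices.card ≤ 4 := Finset.card_le_four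

lemma norm_le_two_of_mem_squareVertices {z : ℂ} (hz : z ∈ squareVertices) : ‖z‖ ≤ 2 := by
  refine (Complex.norm_le_abs_re_add_abs_im z).trans ?_
  simp only [squareVertices, Finset.mem_insert, Finset.mem_singleton] at hz
  rcases hz with rfl | rfl | rfl | rfl <;> norm_num

lemma mem_convexHull_squareVertices {z : ℂ} (hz : ‖z‖ ≤ 1) :
    z ∈ convexHull ℝ (squareVertices : Set ℂ) := by
  have h : (squareVertices : Set ℂ) = ({-1, 1} : Set ℝ) ×ℂ ({-1, 1} : Set ℝ) := by
    ext w
    simp only [squareVertices, Finset.coe_insert, Finset.coe_singleton, Set.mem_insert_iff,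
      Set.mem_singleton_iff, Complex.mem_reProdIm, Complex.ext_iff]
    tauto
  rw [h, Complex.convexHull_reProdIm, convexHull_pair, segment_eq_Icc (by norm_num),
    Complex.mem_reProdIm]
  exact ⟨abs_le.1 ((Complex.abs_re_le_norm z).trans hz),
    abs_le.1 ((Complex.abs_im_le_norm z).trans hz)⟩

lemma convexOn_norm_mul_add (α β : ℂ) : ConvexOn ℝ Set.univ fun z : ℂ => ‖α * z + β‖ := by
  refine ⟨convex_univ, fun x _ y _ a b ha hb hab => ?_⟩
  have h : α * (a • x + b • y) + β = a • (α * x + β) + b • (α * y + β) := by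
    have : (a : ℂ) + b = 1 := by exact_mod_cast hab
    simp only [Complex.real_smul]
    linear_combination -β * this
  dsimp only
  rw [h]
  refine (norm_add_le _ _).trans (le_of_eq ?_)
  rw [norm_smul, norm_smul, Real.norm_of_nonneg ha, Real.norm_of_nonneg hb, smul_eq_mul,
    smul_eq_mul]

/-- A sum of products of factors that depend on separate coordinates of `g` is, in norm, convex in
each coordinate of `g`. -/
lemma convexOn_norm_sum_prod_update {J σ : Type*} [Fintype J] [DecidableEq J] [DecidableEq σ]
    (s : Finset ℕ) (c : ℕ → ℂ) (κ : J → ℕ → σ) (g : J × σ → ℂ) (i : J × σ) :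
    ConvexOn ℝ Set.univ fun z =>
      ‖∑ n ∈ s, c n * ∏ j, Function.update g i z (j, κ j n)‖ := by
  classical
  have h : ∀ n, ∃ α β : ℂ, ∀ z, c n * ∏ j, Function.update g i z (j, κ j n) = α * z + β := by
    intro n
    have hrest : ∀ z, ∏ j ∈ Finset.univ.erase i.1, Function.update g i z (j, κ j n) =
        ∏ j ∈ Finset.univ.erase i.1, g (j, κ j n) := fun z =>
      Finset.prod_congr rfl fun j hj => Function.update_of_ne
        (fun he => (Finset.ne_of_mem_erase hj) (by rw [← he])) _ _
    by_cases hi : κ i.1 n = i.2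
    · refine ⟨c n * ∏ j ∈ Finset.univ.erase i.1, g (j, κ j n), 0, fun z => ?_⟩
      rw [← Finset.mul_prod_erase _ _ (Finset.mem_univ i.1), hrest, hi, Function.update_self]
      ring
    · refine ⟨0, c n * ∏ j, g (j, κ j n), fun z => ?_⟩
      rw [zero_mul, zero_add]
      congr 1
      refine Finset.prod_congr rfl fun j _ => Function.update_of_ne (fun he => hi ?_) _ _
      rw [← he]
  choose α β h using h
  simp_rw [h, Finset.sum_add_distrib, ← Finset.sum_mul]
  exact convexOn_norm_mul_add _ _

/-! ### Complex weights and the union bound -/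

namespace IsRandomIndicator

variable {Ω : Type*} [MeasurableSpace Ω] {P : Measure Ω} [IsProbabilityMeasure P]
  {u : ℕ → ℝ} {U : ℕ → Ω → ℝ}

/-- If the norm exceeds `2B`, the real or the imaginary part has modulus at least `B`; with the two
signs this makes four real events. -/
lemma measure_norm_sum_gt_le (hU : IsRandomIndicator P u U) (N : ℕ) (a : ℕ → ℂ) {A t : ℝ}
    (hA : 0 < A) (ha : ∀ n, ‖a n‖ ≤ A) (ht : 0 ≤ t) (htA : t ≤ 2 * A) :
    P.real {ω | 2 * (t * ∑ n ∈ Finset.range N, u n) <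
        ‖∑ n ∈ Finset.range N, ((U n ω - u n : ℝ) : ℂ) * a n‖} ≤
      4 * Real.exp (-(t ^ 2 * (∑ n ∈ Finset.range N, u n) / (4 * A ^ 2))) := by
  set B := t * ∑ n ∈ Finset.range N, u n with hB
  set S : (ℕ → ℝ) → Set Ω := fun b => {ω | B ≤ ∑ n ∈ Finset.range N, b n * (U n ω - u n)} with hS
  have hsub : {ω | 2 * B < ‖∑ n ∈ Finset.range N, ((U n ω - u n : ℝ) : ℂ) * a n‖} ⊆
      (S (fun n => (a n).re) ∪ S (fun n => -(a n).re)) ∪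
        (S (fun n => (a n).im) ∪ S (fun n => -(a n).im)) := by
    intro ω hω
    have hω' := lt_of_lt_of_le hω.out (Complex.norm_le_abs_re_add_abs_im _)
    simp only [Complex.re_sum, Complex.im_sum, Complex.re_ofReal_mul, Complex.im_ofReal_mul] at hω'
    by_contra hcon
    simp only [hS, Set.mem_union, Set.mem_ofPred_eq, not_or, not_le, neg_mul,
      Finset.sum_neg_distrib] at hcon
    simp only [mul_comm (_ - _ : ℝ)] at hω'
    obtain ⟨⟨h1, h2⟩, h3, h4⟩ := hcon
    have := abs_lt.2 ⟨by linarith, h1⟩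
    have := abs_lt.2 ⟨by linarith, h3⟩
    linarith
  have hbd : ∀ b : ℕ → ℝ, (∀ n, |b n| ≤ A) → P.real (S b) ≤ _ := fun b hb =>
    hU.measure_sum_ge_le N b hA hb ht htA
  have h1 := hbd (fun n => (a n).re) fun n => (Complex.abs_re_le_norm _).trans (ha n)
  have h2 := hbd (fun n => -(a n).re) fun n => by
    rw [abs_neg]; exact (Complex.abs_re_le_norm _).trans (ha n)
  have h3 := hbd (fun n => (a n).im) fun n => (Complex.abs_im_le_norm _).trans (ha n)
  have h4 := hbd (fun n => -(a n).im) fun n => by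
    rw [abs_neg]; exact (Complex.abs_im_le_norm _).trans (ha n)
  refine (measureReal_mono hsub).trans ((measureReal_union_le _ _).trans ?_)
  refine (add_le_add (measureReal_union_le _ _) (measureReal_union_le _ _)).trans ?_
  linarith

/-- Uniform bound over all functions `g` of modulus at most one, by a union bound over the choices
of vertices. -/
lemma measure_exists_norm_sum_gt_le (hU : IsRandomIndicator P u U) {J σ : Type*} [Fintype J]
    [Fintype σ] (N : ℕ) (κ : J → ℕ → σ) {t : ℝ} (ht : 0 ≤ t) (ht1 : t ≤ 1) :
    P.real {ω | ∃ g : J × σ → ℂ, (∀ i, ‖g i‖ ≤ 1) ∧ 2 * (t * ∑ n ∈ Finset.range N, u n) <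
        ‖∑ n ∈ Finset.range N, ((U n ω - u n : ℝ) : ℂ) * ∏ j, g (j, κ j n)‖} ≤
      4 ^ (Fintype.card J * Fintype.card σ) * (4 * Real.exp
        (-(t ^ 2 * (∑ n ∈ Finset.range N, u n) / (4 * (2 ^ Fintype.card J) ^ 2)))) := by
  classical
  set B := 2 * (t * ∑ n ∈ Finset.range N, u n) with hB
  let bad : (J × σ → ℂ) → Set Ω := fun g =>
    {ω | B < ‖∑ n ∈ Finset.range N, ((U n ω - u n : ℝ) : ℂ) * ∏ j, g (j, κ j n)‖}
  let V : Finset (J × σ → ℂ) := Fintype.piFinset fun _ => squareVertices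
  have hV : (V.card : ℝ) ≤ 4 ^ (Fintype.card J * Fintype.card σ) := by
    have : V.card ≤ 4 ^ (Fintype.card J * Fintype.card σ) := by
      rw [Fintype.card_piFinset, Finset.prod_const, Finset.card_univ, Fintype.card_prod]
      exact Nat.pow_le_pow_left card_squareVertices_le _
    exact_mod_cast this
  have hsub : {ω | ∃ g : J × σ → ℂ, (∀ i, ‖g i‖ ≤ 1) ∧ B <
      ‖∑ n ∈ Finset.range N, ((U n ω - u n : ℝ) : ℂ) * ∏ j, g (j, κ j n)‖} ⊆
      ⋃ g ∈ V, bad g := by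
    rintro ω ⟨g, hg, hlt⟩
    by_contra hcon
    simp only [bad, Set.mem_iUnion, Set.mem_ofPred_eq, exists_prop, not_exists, not_and, not_lt]
      at hcon
    refine absurd hlt (not_lt.2 ?_)
    refine le_of_forall_vertices_le (V := (squareVertices : Set ℂ))
      (fun g i => convexOn_norm_sum_prod_update (Finset.range N)
        (fun n => ((U n ω - u n : ℝ) : ℂ)) κ g i)
      (fun g hg => hcon g (Fintype.mem_piFinset.2 hg)) g
      fun i => mem_convexHull_squareVertices (hg i)
  refine (measureReal_mono hsub (measure_ne_top _ _)).trans
    ((measureReal_biUnion_finset_le _ _).trans ?_)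
  calc _ ≤ ∑ g ∈ V, 4 * Real.exp
        (-(t ^ 2 * (∑ n ∈ Finset.range N, u n) / (4 * (2 ^ Fintype.card J) ^ 2))) := by
        -- Vertices have modulus at most 2, so the products are bounded by `A = 2 ^ card J`.
        refine Finset.sum_le_sum fun g hg => hU.measure_norm_sum_gt_le N _ (by positivity)
          (fun n => ?_) ht ?_
        · rw [norm_prod, ← Finset.card_univ, ← Finset.prod_const]
          exact Finset.prod_le_prod (fun _ _ => norm_nonneg _) fun j _ =>
            norm_le_two_of_mem_squareVertices (Fintype.mem_piFinset.1 hg _)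
        · have : (1 : ℝ) ≤ 2 ^ Fintype.card J := one_le_pow₀ (by norm_num)
          linarith
    _ ≤ _ := by
        rw [Finset.sum_const, nsmul_eq_mul]
        gcongr

end IsRandomIndicator

/-! ### Growth of the expected counts, and Borel–Cantelli -/

/-- Monotonicity starts at index 1, which leaves `N - 1 ≥ N / 2` terms. -/
lemma half_mul_le_sum_of_antitoneOn {u : ℕ → ℝ} (hu : ∀ n, 0 ≤ u n)
    (hmono : AntitoneOn u (Set.Ici 1)) {N : ℕ} (hN : 2 ≤ N) :
    (N : ℝ) / 2 * u N ≤ ∑ n ∈ Finset.range N, u n := by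
  have h1 : ∑ n ∈ Finset.Ico 1 N, u N ≤ ∑ n ∈ Finset.Ico 1 N, u n :=
    Finset.sum_le_sum fun n hn => by
      rw [Finset.mem_Ico] at hn
      exact hmono (Set.mem_Ici.2 hn.1) (Set.mem_Ici.2 (by omega)) hn.2.le
  have h2 : ∑ n ∈ Finset.Ico 1 N, u n ≤ ∑ n ∈ Finset.range N, u n :=
    Finset.sum_le_sum_of_subset_of_nonneg (fun n hn => by
      rw [Finset.mem_Ico] at hn; simpa using hn.2) fun n _ _ => hu n
  rw [Finset.sum_const, Nat.card_Ico, nsmul_eq_mul, Nat.cast_sub (by omega)] at h1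
  have h3 : (2 : ℝ) ≤ N := by exact_mod_cast hN
  refine (mul_le_mul_of_nonneg_right ?_ (hu N)).trans (h1.trans h2)
  push_cast
  linarith

/-- The rate `(log N)^(-(1 + δ/2))`, summable along lacunary sequences of `N`. -/
noncomputable def logRate (δ : ℝ) (N : ℕ) : ℝ := Real.log N ^ (-(1 + δ / 2))

lemma logRate_nonneg (δ : ℝ) (N : ℕ) : 0 ≤ logRate δ N :=
  Real.rpow_nonneg (Real.log_natCast_nonneg N) _

lemma tendsto_log_natCast : Tendsto (fun N : ℕ => Real.log N) atTop atTop :=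
  Real.tendsto_log_atTop.comp tendsto_natCast_atTop_atTop

lemma tendsto_logRate {δ : ℝ} (hδ : 0 < δ) : Tendsto (logRate δ) atTop (𝓝 0) :=
  (tendsto_rpow_neg_atTop (by positivity)).comp tendsto_log_natCast

lemma logRate_sq_mul {δ : ℝ} {N : ℕ} (hN : 0 < Real.log N) :
    logRate δ N ^ 2 * Real.log N ^ (2 + δ) = 1 := by
  rw [logRate, ← Real.rpow_natCast, ← Real.rpow_mul hN.le, ← Real.rpow_add hN]
  convert Real.rpow_zero _ using 2
  push_cast; ring

/-- With `y = N^{1/(ℓ+1)}`, the sum is at least `N u_N / 2 = y^ℓ (u_N y) / 2`. The growth hypothesis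
bounds `u_N y` below by `2C log^{2+δ} N`, and the squared rate cancels exactly this logarithm. The
Chernoff exponent thus beats any multiple of `y^ℓ`, the order of the number of free values. -/
lemma eventually_le_logRate_sq_mul_sum {u : ℕ → ℝ} (hu : ∀ n, 0 ≤ u n)
    (hmono : AntitoneOn u (Set.Ici 1)) (ℓ : ℕ) {δ : ℝ}
    (hgrowth : Tendsto
      (fun n : ℕ => u n * ((n : ℝ) ^ ((1 : ℝ) / ((ℓ : ℝ) + 1)) / Real.log (n : ℝ) ^ (2 + δ)))
      atTop atTop) (C : ℝ) :
    ∀ᶠ N : ℕ in atTop, C * ((N : ℝ) ^ ((1 : ℝ) / ((ℓ : ℝ) + 1))) ^ ℓ ≤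
      logRate δ N ^ 2 * ∑ n ∈ Finset.range N, u n := by
  filter_upwards [hgrowth.eventually_ge_atTop (2 * C), eventually_ge_atTop 2,
    tendsto_log_natCast.eventually_gt_atTop 0] with N hN hN2 hL
  set y := (N : ℝ) ^ ((1 : ℝ) / ((ℓ : ℝ) + 1)) with hy
  have hNpos : (0 : ℝ) < N := by positivity
  have hypos : 0 < y := Real.rpow_pos_of_pos hNpos _
  have hyN : y ^ (ℓ + 1) = N := by
    rw [hy, ← Real.rpow_natCast, ← Real.rpow_mul hNpos.le]
    push_cast
    rw [one_div_mul_cancel (by positivity), Real.rpow_one]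
  have hLp : 0 < Real.log N ^ (2 + δ) := Real.rpow_pos_of_pos hL _
  rw [← mul_div_assoc, le_div_iff₀ hLp] at hN
  have h1 := half_mul_le_sum_of_antitoneOn hu hmono hN2
  calc C * y ^ ℓ = logRate δ N ^ 2 * Real.log N ^ (2 + δ) * (C * y ^ ℓ) := by
        rw [logRate_sq_mul hL, one_mul]
    _ = logRate δ N ^ 2 * (2 * C * Real.log N ^ (2 + δ) * (y ^ ℓ / 2)) := by ring
    _ ≤ logRate δ N ^ 2 * (u N * y * (y ^ ℓ / 2)) := by gcongr
    _ = logRate δ N ^ 2 * ((N : ℝ) / 2 * u N) := by rw [← hyN]; ring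
    _ ≤ _ := by gcongr

lemma tendsto_sum_atTop_of_growth {u : ℕ → ℝ} (hu : ∀ n, 0 ≤ u n)
    (hmono : AntitoneOn u (Set.Ici 1)) (ℓ : ℕ) {δ : ℝ} (hδ : 0 < δ)
    (hgrowth : Tendsto
      (fun n : ℕ => u n * ((n : ℝ) ^ ((1 : ℝ) / ((ℓ : ℝ) + 1)) / Real.log (n : ℝ) ^ (2 + δ)))
      atTop atTop) :
    Tendsto (fun N => ∑ n ∈ Finset.range N, u n) atTop atTop := by
  refine tendsto_atTop.2 fun C => ?_
  filter_upwards [eventually_le_logRate_sq_mul_sum hu hmono ℓ hgrowth (max C 0),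
    (tendsto_logRate hδ).eventually_le_const zero_lt_one, eventually_ge_atTop 1] with N h1 h2 h3
  have hy : 1 ≤ (N : ℝ) ^ ((1 : ℝ) / ((ℓ : ℝ) + 1)) :=
    Real.one_le_rpow (by exact_mod_cast h3) (by positivity)
  have hw : 0 ≤ ∑ n ∈ Finset.range N, u n := Finset.sum_nonneg fun n _ => hu n
  calc C ≤ max C 0 := le_max_left _ _
    _ ≤ max C 0 * _ := le_mul_of_one_le_right (le_max_right _ _) (one_le_pow₀ hy)
    _ ≤ _ := h1
    _ ≤ _ := mul_le_of_le_one_left hw (pow_le_one₀ (logRate_nonneg δ N) h2)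

/-- Almost surely, for all large `N`, the centred weights are uniformly almost orthogonal to all
products along progressions with `ℓ + 1` terms and step `n` started at suitable points `h n`. -/
theorem IsRandomIndicator.ae_eventually_exists_shift {Ω : Type*} [MeasurableSpace Ω]
    {P : Measure Ω} [IsProbabilityMeasure P] {ℓ : ℕ} (hℓ : 1 ≤ ℓ) {u : ℕ → ℝ} {U : ℕ → Ω → ℝ}
    (hU : IsRandomIndicator P u U) (hmono : AntitoneOn u (Set.Ici 1)) {δ : ℝ} (hδ : 0 < δ)
    (hgrowth : Tendsto
      (fun n : ℕ => u n * ((n : ℝ) ^ ((1 : ℝ) / ((ℓ : ℝ) + 1)) / Real.log (n : ℝ) ^ (2 + δ)))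
      atTop atTop) :
    ∀ᵐ ω ∂P, ∀ᶠ N in atTop, ∃ h : ℕ → ℕ, ∀ f : Fin (ℓ + 1) → ℕ → ℂ, (∀ j m, ‖f j m‖ ≤ 1) →
      ‖∑ n ∈ Finset.range N, ((U n ω - u n : ℝ) : ℂ) * ∏ j, f j (h n + (j : ℕ) * n)‖ ≤
        2 * (logRate δ N * ∑ n ∈ Finset.range N, u n) := by
  -- The added 1 keeps the base positive when `N = 0`.
  let q : ℕ → ℕ := fun N => ⌈(N : ℝ) ^ ((1 : ℝ) / ((ℓ : ℝ) + 1))⌉₊ + 1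
  have hqpos : ∀ N, 0 < q N := fun N => Nat.succ_pos _
  have hqN : ∀ N, N ≤ q N ^ (ℓ + 1) := by
    intro N
    have h1 : (N : ℝ) ^ ((1 : ℝ) / ((ℓ : ℝ) + 1)) ≤ q N := by
      simp only [q]; push_cast
      linarith [Nat.le_ceil ((N : ℝ) ^ ((1 : ℝ) / ((ℓ : ℝ) + 1)))]
    have h2 : ((N : ℝ) ^ ((1 : ℝ) / ((ℓ : ℝ) + 1))) ^ (ℓ + 1) = N := by
      rw [← Real.rpow_natCast, ← Real.rpow_mul (Nat.cast_nonneg N)]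
      push_cast
      rw [one_div_mul_cancel (by positivity), Real.rpow_one]
    have h3 := pow_le_pow_left₀ (by positivity) h1 (ℓ + 1)
    rw [h2] at h3
    exact_mod_cast h3
  choose h κ E hE using fun N => exists_digit_separation ℓ (q N) (hqpos N)
  let bad : ℕ → Set Ω := fun N => {ω | ∃ g : Fin (ℓ + 1) × (Fin ℓ → Fin (q N)) → ℂ,
    (∀ i, ‖g i‖ ≤ 1) ∧ 2 * (logRate δ N * ∑ n ∈ Finset.range N, u n) <
      ‖∑ n ∈ Finset.range N, ((U n ω - u n : ℝ) : ℂ) * ∏ j, g (j, κ N j n)‖}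
  have hbad : ∀ᶠ N : ℕ in atTop, P.real (bad N) ≤ 4 * (1 / (N : ℝ) ^ 2) := by
    -- The first factor of the constant is the Chernoff denominator. In the second, `2(ℓ+1)3^ℓ` pays
    -- for the logarithm of the number of choices (`log 4 ≤ 2`, `q ≤ 3y`), and `2(ℓ+1)` pays for `2
    -- log N`, leaving a summable `N⁻²`.
    filter_upwards [eventually_le_logRate_sq_mul_sum hU.prob_nonneg hmono ℓ hgrowth
        (4 * (2 ^ (ℓ + 1)) ^ 2 * (2 * ((ℓ + 1) * 3 ^ ℓ) + 2 * (ℓ + 1))),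
      (tendsto_logRate hδ).eventually_le_const zero_lt_one, eventually_ge_atTop 1] with N h1 h2 h3
    refine (hU.measure_exists_norm_sum_gt_le N (κ N) (logRate_nonneg δ N) h2).trans ?_
    simp only [Fintype.card_fin, Fintype.card_fun]
    set y := (N : ℝ) ^ ((1 : ℝ) / ((ℓ : ℝ) + 1)) with hy
    have hNpos : (0 : ℝ) < N := by positivity
    have hy1 : 1 ≤ y := Real.one_le_rpow (by exact_mod_cast h3) (by positivity)
    have hqy : (q N : ℝ) ≤ 3 * y := by
      simp only [q]; push_cast
      linarith [Nat.ceil_lt_add_one (by positivity : 0 ≤ y)]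
    have hlog : Real.log N ≤ (ℓ + 1) * y ^ ℓ := by
      have : Real.log y = 1 / (ℓ + 1) * Real.log N := Real.log_rpow hNpos _
      have h4 : Real.log N = (ℓ + 1) * Real.log y := by rw [this]; field_simp
      rw [h4]
      gcongr
      exact (Real.log_le_self (by positivity)).trans (le_self_pow₀ hy1 (by omega))
    have hlog4 : Real.log 4 ≤ 2 := by
      have : Real.log 4 = 2 * Real.log 2 := by
        rw [show (4 : ℝ) = 2 ^ 2 by norm_num, Real.log_pow]; norm_num
      linarith [Real.log_two_lt_d9]
    set X := logRate δ N ^ 2 * (∑ n ∈ Finset.range N, u n) / (4 * (2 ^ (ℓ + 1)) ^ 2) with hX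
    have hXge : (2 * ((ℓ + 1) * 3 ^ ℓ) + 2 * (ℓ + 1)) * y ^ ℓ ≤ X := by
      rw [hX, le_div_iff₀ (by positivity)]
      linarith
    have hcount : Real.log 4 * (((ℓ + 1) * q N ^ ℓ : ℕ) : ℝ) ≤ 2 * ((ℓ + 1) * 3 ^ ℓ) * y ^ ℓ := by
      push_cast
      calc _ ≤ 2 * ((ℓ + 1) * (3 * y) ^ ℓ) := by gcongr
        _ = _ := by rw [mul_pow]; ring
    have h4 : (4 : ℝ) ^ ((ℓ + 1) * q N ^ ℓ) =
        Real.exp (Real.log 4 * (((ℓ + 1) * q N ^ ℓ : ℕ) : ℝ)) := by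
      rw [← Real.rpow_natCast, Real.rpow_def_of_pos (by norm_num)]
    have h5 : 1 / (N : ℝ) ^ 2 = Real.exp (-(2 * Real.log N)) := by
      rw [Real.exp_neg, mul_comm, Real.exp_mul, Real.exp_log hNpos, one_div]
      norm_num
    rw [h4, h5, mul_left_comm, ← Real.exp_add]
    gcongr
    linarith
  have hsum : ∑' N, P (bad N) ≠ ⊤ := by
    have hs : Summable fun N => P.real (bad N) := by
      refine Summable.of_norm_bounded_eventually_nat
        ((Real.summable_one_div_nat_pow.2 one_lt_two).mul_left 4) ?_
      filter_upwards [hbad] with N hN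
      rwa [Real.norm_of_nonneg measureReal_nonneg]
    have := hs.tsum_ofReal_ne_top
    simpa only [ofReal_measureReal (measure_ne_top P _)] using this
  filter_upwards [ae_eventually_notMem hsum] with ω hω
  filter_upwards [hω] with N hN
  refine ⟨h N, fun f hf => ?_⟩
  by_contra hcon
  -- A violating `f`, read through `E`, is a violating assignment of values to digit patterns.
  refine hN ⟨fun i => f i.1 (E N i.1 i.2), fun i => hf _ _, ?_⟩
  refine (not_le.1 hcon).trans_eq (congrArg _ (Finset.sum_congr rfl fun n hn => ?_))
  simp only [hE N n ((Finset.mem_range.1 hn).trans_le (hqN N))]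

/-! ### Transfer to measure preserving systems -/

section Systems

variable {X : Type*} [MeasurableSpace X] {μ : Measure X} {T : X → X}

/-- Invariance replaces `x` by `T^{h n} x` in the `n`-th integral; the hypothesis then applies
pointwise to the orbit sequences `m ↦ F j (T^m x)`. -/
lemma norm_integral_sum_le_of_shift [IsProbabilityMeasure μ] (hT : MeasurePreserving T μ μ)
    {J : ℕ} {N : ℕ} {c : ℕ → ℂ}
    {h : ℕ → ℕ} {B : ℝ}
    (hB : ∀ f : Fin J → ℕ → ℂ, (∀ j m, ‖f j m‖ ≤ 1) →
      ‖∑ n ∈ Finset.range N, c n * ∏ j, f j (h n + (j : ℕ) * n)‖ ≤ B)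
    {F : Fin J → X → ℂ} (hF : ∀ j, Measurable (F j)) (hF1 : ∀ j x, ‖F j x‖ ≤ 1) :
    ‖∫ x, ∑ n ∈ Finset.range N, c n * ∏ j, F j (T^[(j : ℕ) * n] x) ∂μ‖ ≤ B := by
  have hmeas : ∀ k : Fin J → ℕ, Measurable fun x => ∏ j, F j (T^[k j] x) := fun k =>
    Finset.measurable_prod _ fun j _ => (hF j).comp (hT.measurable.iterate _)
  have hint : ∀ k : Fin J → ℕ, Integrable (fun x => ∏ j, F j (T^[k j] x)) μ := fun k =>
    Integrable.of_bound (hmeas k).aestronglyMeasurable 1 (ae_of_all _ fun x => by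
      rw [norm_prod]
      exact Finset.prod_le_one (fun _ _ => norm_nonneg _) fun j _ => hF1 j _)
  have hshift : ∀ n, ∫ x, ∏ j, F j (T^[(j : ℕ) * n] x) ∂μ =
      ∫ x, ∏ j, F j (T^[h n + (j : ℕ) * n] x) ∂μ := by
    intro n
    have hi := hT.iterate (h n)
    have := integral_map hi.measurable.aemeasurable
      (hmeas fun j => (j : ℕ) * n).aestronglyMeasurable (μ := μ)
    rw [hi.map_eq] at this
    rw [this]
    simp_rw [← Function.iterate_add_apply, add_comm]
  rw [integral_finsetSum _ fun n _ => (hint _).const_mul _]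
  simp_rw [integral_const_mul, hshift, ← integral_const_mul]
  rw [← integral_finsetSum _ fun n _ => (hint _).const_mul _]
  refine (norm_integral_le_of_norm_le_const (ae_of_all _ fun x =>
    hB (fun j m => F j (T^[m] x)) fun j m => hF1 j _)).trans ?_
  simp

lemma measurable_multipleProduct (hT : Measurable T) {ℓ : ℕ} {F : Fin ℓ → X → ℂ}
    (hF : ∀ j, Measurable (F j)) (n : ℕ) : Measurable (multipleProduct T F n) :=
  Finset.measurable_prod _ fun j _ => (hF j).comp (hT.iterate _)

omit [MeasurableSpace X] in
lemma norm_multipleProduct_le_one {ℓ : ℕ} {F : Fin ℓ → X → ℂ} (hF1 : ∀ j x, ‖F j x‖ ≤ 1) (n : ℕ)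
    (x : X) : ‖multipleProduct T F n x‖ ≤ 1 := by
  rw [multipleProduct, norm_prod]
  exact Finset.prod_le_one (fun _ _ => norm_nonneg _) fun j _ => hF1 j _

/-- Duality: the zeroth factor is not moved by `n`, so `conj D / K` in that place turns the sum into
`‖D‖² / K`. -/
lemma integral_norm_sq_le_of_shift [IsProbabilityMeasure μ] (hT : MeasurePreserving T μ μ)
    {ℓ : ℕ} {N : ℕ} {c : ℕ → ℝ}
    {h : ℕ → ℕ} {B K : ℝ}
    (hB : ∀ f : Fin (ℓ + 1) → ℕ → ℂ, (∀ j m, ‖f j m‖ ≤ 1) →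
      ‖∑ n ∈ Finset.range N, (c n : ℂ) * ∏ j, f j (h n + (j : ℕ) * n)‖ ≤ B)
    {F : Fin ℓ → X → ℂ} (hF : ∀ j, Measurable (F j)) (hF1 : ∀ j x, ‖F j x‖ ≤ 1)
    (hK : 0 < K) (hcK : ∑ n ∈ Finset.range N, |c n| ≤ K) :
    ∫ x, ‖∑ n ∈ Finset.range N, c n • multipleProduct T F n x‖ ^ 2 ∂μ ≤ K * B := by
  set D : X → ℂ := fun x => ∑ n ∈ Finset.range N, c n • multipleProduct T F n x with hD
  have hDm : Measurable D := Finset.measurable_sum _ fun n _ =>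
    (measurable_multipleProduct hT.measurable hF n).const_smul (c n)
  have hDK : ∀ x, ‖D x‖ ≤ K := fun x => by
    refine (norm_sum_le _ _).trans (le_trans (Finset.sum_le_sum fun n _ => ?_) hcK)
    rw [norm_smul, Real.norm_eq_abs]
    exact mul_le_of_le_one_right (abs_nonneg _) (norm_multipleProduct_le_one hF1 n x)
  let F₀ : X → ℂ := fun x => (K : ℂ)⁻¹ * (starRingEnd ℂ) (D x)
  have hF₀ : ∀ x, ‖F₀ x‖ ≤ 1 := fun x => by
    simp only [F₀, norm_mul, norm_inv, RCLike.norm_conj, Complex.norm_real,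
      Real.norm_of_nonneg hK.le]
    rw [inv_mul_le_iff₀ hK, mul_one]
    exact hDK x
  have hF₀m : Measurable F₀ := (Complex.continuous_conj.measurable.comp hDm).const_mul _
  have key := norm_integral_sum_le_of_shift hT hB
    (F := (Fin.cons F₀ F : Fin (ℓ + 1) → X → ℂ))
    (fun j => by refine Fin.cases ?_ (fun j => ?_) j <;> simp [hF₀m, hF])
    (fun j x => by
      refine Fin.cases ?_ (fun j => ?_) j
      · simpa using hF₀ x
      · simpa using hF1 j x)
  have hpt : ∀ x, ∑ n ∈ Finset.range N, (c n : ℂ) *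
      ∏ j, (Fin.cons F₀ F : Fin (ℓ + 1) → X → ℂ) j (T^[(j : ℕ) * n] x) =
        ((K⁻¹ * ‖D x‖ ^ 2 : ℝ) : ℂ) := by
    intro x
    have h1 : ∑ n ∈ Finset.range N, (c n : ℂ) *
        ∏ j, (Fin.cons F₀ F : Fin (ℓ + 1) → X → ℂ) j (T^[(j : ℕ) * n] x) = F₀ x * D x := by
      simp only [hD, Finset.mul_sum, Fin.prod_univ_succ, Fin.cons_zero, Fin.cons_succ, Fin.val_zero,
        zero_mul, Function.iterate_zero, id, Fin.val_succ, multipleProduct, Complex.real_smul]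
      exact Finset.sum_congr rfl fun n _ => by ring
    rw [h1]
    simp only [F₀]
    rw [mul_assoc, mul_comm ((starRingEnd ℂ) (D x)), Complex.mul_conj, Complex.normSq_eq_norm_sq]
    push_cast
    rfl
  simp_rw [hpt] at key
  rw [integral_complex_ofReal, Complex.norm_real, integral_const_mul] at key
  have := (le_abs_self _).trans key
  rwa [inv_mul_le_iff₀ hK] at this

end Systems

/-! ### From summable integrals to convergence along all `N` -/

/-- The series `∑ f k` has a finite integral, so it converges almost everywhere and its terms tend
to zero. -/
lemma ae_tendsto_zero_of_integral_le_summable {X : Type*} [MeasurableSpace X] {μ : Measure X}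
    {f : ℕ → X → ℝ} {b : ℕ → ℝ} (hfm : ∀ k, Measurable (f k)) (hf0 : ∀ k x, 0 ≤ f k x)
    (hfi : ∀ k, Integrable (f k) μ) (hb : Summable b)
    (hfb : ∀ᶠ k in atTop, ∫ x, f k x ∂μ ≤ b k) :
    ∀ᵐ x ∂μ, Tendsto (fun k => f k x) atTop (𝓝 0) := by
  have hs : Summable fun k => ∫ x, f k x ∂μ := by
    refine Summable.of_norm_bounded_eventually_nat hb ?_
    filter_upwards [hfb] with k hk
    rwa [Real.norm_of_nonneg (integral_nonneg (hf0 k))]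
  have h1 : ∫⁻ x, ∑' k, ENNReal.ofReal (f k x) ∂μ ≠ ⊤ := by
    rw [lintegral_tsum fun k => (hfm k).ennreal_ofReal.aemeasurable]
    simp_rw [← ofReal_integral_eq_lintegral_ofReal (hfi _) (ae_of_all _ (hf0 _))]
    exact hs.tsum_ofReal_ne_top
  filter_upwards [ae_lt_top (Measurable.tsum fun k => (hfm k).ennreal_ofReal) h1] with x hx
  have := (ENNReal.tendsto_toReal ENNReal.zero_ne_top).comp
    (ENNReal.tendsto_atTop_zero_of_tsum_ne_top hx.ne)
  simpa [Function.comp_def, ENNReal.toReal_ofReal, hf0] using this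

/-- The added terms total at most `(M - N) u_N ≤ ε N u_N`, and `N u_N` is at most twice the sum up
to `N`. -/
lemma sum_range_le_of_antitoneOn {u : ℕ → ℝ} (hu : ∀ n, 0 ≤ u n)
    (hmono : AntitoneOn u (Set.Ici 1)) {N M : ℕ} (hN : 2 ≤ N) (hNM : N ≤ M) {ε : ℝ}
    (hM : (M : ℝ) - N ≤ ε * N) :
    ∑ n ∈ Finset.range M, u n ≤ (1 + 2 * ε) * ∑ n ∈ Finset.range N, u n := by
  have h1 := half_mul_le_sum_of_antitoneOn hu hmono hN
  have hNpos : (0 : ℝ) < N := by positivity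
  have hε : 0 ≤ ε := by
    have : (N : ℝ) ≤ M := by exact_mod_cast hNM
    by_contra! h
    nlinarith
  have h2 : ∑ n ∈ Finset.Ico N M, u n ≤ ∑ n ∈ Finset.Ico N M, u N :=
    Finset.sum_le_sum fun n hn => by
      rw [Finset.mem_Ico] at hn
      exact hmono (Set.mem_Ici.2 (by omega)) (Set.mem_Ici.2 (by omega)) hn.1
  rw [Finset.sum_const, Nat.card_Ico, nsmul_eq_mul, Nat.cast_sub hNM] at h2
  rw [← Finset.sum_range_add_sum_Ico _ hNM]
  have h3 : ((M : ℝ) - N) * u N ≤ ε * N * u N := mul_le_mul_of_nonneg_right hM (hu N)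
  nlinarith

/-- Convergence along nearly geometric subsequences implies convergence, when the increments of `D`
are dominated by those of a function `V` comparable to the normalization `w`. -/
lemma tendsto_zero_of_subseq {E : Type*} [NormedAddCommGroup E] {D : ℕ → E} {V w : ℕ → ℝ}
    (hV : Monotone V) (hD : ∀ N M, N ≤ M → ‖D M - D N‖ ≤ V M - V N) (hw : Monotone w)
    (hwpos : ∀ᶠ N in atTop, 0 < w N) {L : ℝ} (hVw : Tendsto (fun N => V N / w N) atTop (𝓝 L))
    (hc : ∀ ε > 0, ∃ c : ℕ → ℕ, Monotone c ∧ Tendsto c atTop atTop ∧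
      (∀ᶠ k in atTop, w (c (k + 1)) ≤ (1 + ε) * w (c k)) ∧
      Tendsto (fun k => ‖D (c k)‖ / w (c k)) atTop (𝓝 0)) :
    Tendsto (fun N => ‖D N‖ / w N) atTop (𝓝 0) := by
  have hbound : ∀ η > 0, η ≤ 1 → ∀ᶠ N in atTop, ‖D N‖ / w N ≤ (|L| + 4) * η := by
    intro η hη hη1
    obtain ⟨c, hcm, hct, hcw, hcD⟩ := hc η hη
    have hVw' : ∀ᶠ N in atTop, 0 < w N ∧ (L - η) * w N ≤ V N ∧ V N ≤ (L + η) * w N := by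
      filter_upwards [hwpos, hVw.eventually_const_le (sub_lt_self L hη),
        hVw.eventually_le_const (lt_add_of_pos_right L hη)] with N h1 h2 h3
      exact ⟨h1, (le_div_iff₀ h1).1 h2, (div_le_iff₀ h1).1 h3⟩
    have hev : ∀ᶠ k in atTop, ‖D (c k)‖ ≤ η * w (c k) ∧ w (c (k + 1)) ≤ (1 + η) * w (c k) ∧
        (0 < w (c k) ∧ (L - η) * w (c k) ≤ V (c k) ∧ V (c k) ≤ (L + η) * w (c k)) ∧
        V (c (k + 1)) ≤ (L + η) * w (c (k + 1)) := by
      filter_upwards [hcD.eventually_le_const hη, hcw, hct.eventually hVw',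
        (hct.comp (tendsto_add_atTop_nat 1)).eventually hVw'] with k h1 h2 h3 h4
      exact ⟨(div_le_iff₀ h3.1).1 h1, h2, h3, h4.2.2⟩
    obtain ⟨K, hK⟩ := eventually_atTop.1 hev
    filter_upwards [eventually_ge_atTop (c K)] with N hN
    obtain ⟨m, hm⟩ := (hct.eventually_gt_atTop N).exists
    have hex : ∃ k, N < c k := ⟨m, hm⟩
    classical
    have hfind := Nat.find_spec hex
    have hKlt : K < Nat.find hex := by
      by_contra! hle
      exact absurd (hfind.trans_le (hcm hle)) (not_lt.2 hN)
    -- This locates the block `c k ≤ N < c (k + 1)`.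
    obtain ⟨k, hk⟩ : ∃ k, Nat.find hex = k + 1 := ⟨Nat.find hex - 1, by omega⟩
    have hkN : c k ≤ N := not_lt.1 (Nat.find_min hex (by omega : k < Nat.find hex))
    rw [hk] at hfind
    obtain ⟨h1, h2, ⟨h3, h4, -⟩, h5⟩ := hK k (by omega)
    have hwN : w (c k) ≤ w N := hw hkN
    rw [div_le_iff₀ (h3.trans_le hwN)]
    have h6 : ‖D N‖ ≤ ‖D (c k)‖ + ‖D N - D (c k)‖ := by
      have := norm_add_le (D (c k)) (D N - D (c k))
      rwa [add_sub_cancel] at this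
    have h7 := hD _ _ hkN
    have h8 : V N ≤ V (c (k + 1)) := hV hfind.le
    -- Of the final `|L| + 4`, `|L| + 2` comes from here, 1 from `‖D (c k)‖` and 1 from the lower
    -- bound on `V (c k)`.
    have h9 : (L + η) * w (c (k + 1)) ≤ L * w (c k) + (|L| + 2) * η * w (c k) := by
      have hwk : w (c k) ≤ w (c (k + 1)) := hw (hkN.trans hfind.le)
      have h10 : L * (w (c (k + 1)) - w (c k)) ≤ |L| * (η * w (c k)) :=
        mul_le_mul (le_abs_self L) (by linarith) (by linarith) (abs_nonneg L)
      have h11 : η * w (c (k + 1)) ≤ η * (2 * w (c k)) :=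
        mul_le_mul_of_nonneg_left (h2.trans (mul_le_mul_of_nonneg_right (by linarith) h3.le)) hη.le
      linarith
    calc ‖D N‖ ≤ (|L| + 4) * η * w (c k) := by linarith
      _ ≤ _ := mul_le_mul_of_nonneg_left hwN (by positivity)
  rw [Metric.tendsto_nhds]
  intro ε hε
  have hL : 0 < |L| + 4 := by positivity
  have hη : 0 < min 1 (ε / (2 * (|L| + 4))) := lt_min one_pos (by positivity)
  filter_upwards [hbound _ hη (min_le_left _ _), hwpos] with N h1 h2
  rw [Real.dist_0_eq_abs, abs_of_nonneg (div_nonneg (norm_nonneg _) h2.le)]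
  refine h1.trans_lt ((mul_le_mul_of_nonneg_left (min_le_right _ _) hL.le).trans_lt ?_)
  rw [show (|L| + 4) * (ε / (2 * (|L| + 4))) = ε / 2 by field_simp]
  linarith

section CeilPow

variable {a : ℝ}

lemma monotone_ceil_pow (ha : 1 < a) : Monotone fun k : ℕ => ⌈a ^ k⌉₊ := fun _ _ hij =>
  Nat.ceil_mono (pow_le_pow_right₀ ha.le hij)

lemma tendsto_ceil_pow (ha : 1 < a) : Tendsto (fun k : ℕ => ⌈a ^ k⌉₊) atTop atTop :=
  tendsto_nat_ceil_atTop.comp (tendsto_pow_atTop_atTop_of_one_lt ha)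

/-- The factor 2 absorbs the rounding error 1, which is at most `(a - 1) ⌈a^k⌉` for large `k`. -/
lemma eventually_ceil_pow_succ_sub_le (ha : 1 < a) :
    ∀ᶠ k : ℕ in atTop, (⌈a ^ (k + 1)⌉₊ : ℝ) - ⌈a ^ k⌉₊ ≤ 2 * (a - 1) * ⌈a ^ k⌉₊ := by
  have h := (tendsto_natCast_atTop_atTop (R := ℝ)).comp (tendsto_ceil_pow ha)
  filter_upwards [h.eventually_ge_atTop (1 / (a - 1))] with k hk
  rw [div_le_iff₀ (by linarith)] at hk
  have h1 := (Nat.ceil_lt_add_one (by positivity : 0 ≤ a ^ (k + 1))).le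
  have h2 := Nat.le_ceil (a ^ k)
  have h3 : a ^ (k + 1) ≤ a * ⌈a ^ k⌉₊ := by rw [pow_succ']; gcongr
  simp only [Function.comp] at hk
  linarith

/-- As `log ⌈a^k⌉ ≥ k log a`, the terms are dominated by a multiple of `k^{-(1+δ/2)}`. -/
lemma summable_logRate_ceil_pow {δ : ℝ} (hδ : 0 < δ) (ha : 1 < a) :
    Summable fun k : ℕ => logRate δ ⌈a ^ k⌉₊ := by
  have hs : Summable fun k : ℕ => Real.log a ^ (-(1 + δ / 2)) * (k : ℝ) ^ (-(1 + δ / 2)) :=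
    (Real.summable_nat_rpow.2 (by linarith)).mul_left _
  refine Summable.of_norm_bounded_eventually_nat hs ?_
  filter_upwards [eventually_ge_atTop 1] with k hk
  have hk' : (0 : ℝ) < k := by positivity
  have hla := Real.log_pos ha
  rw [Real.norm_of_nonneg (logRate_nonneg _ _), ← Real.mul_rpow hla.le hk'.le]
  refine Real.rpow_le_rpow_of_nonpos (by positivity) ?_ (by linarith)
  rw [mul_comm, ← Real.log_pow]
  exact Real.log_le_log (by positivity) (Nat.le_ceil _)

end CeilPow

/-! ### Almost everywhere convergence for a fixed `ω`, and the conclusion -/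

/-- The deterministic part: `a` is a sequence of weights in `[0, 1]` for which `a - u` is uniformly
almost orthogonal to products along progressions. -/
theorem ae_tendsto_differenceAverage {ℓ : ℕ} {a u : ℕ → ℝ} {δ : ℝ} (hδ : 0 < δ)
    (ha : ∀ n, 0 ≤ a n) (hu : ∀ n, 0 ≤ u n) (hmono : AntitoneOn u (Set.Ici 1))
    (hw : Tendsto (fun N => ∑ n ∈ Finset.range N, u n) atTop atTop)
    (hshift : ∀ᶠ N in atTop, ∃ h : ℕ → ℕ, ∀ f : Fin (ℓ + 1) → ℕ → ℂ, (∀ j m, ‖f j m‖ ≤ 1) →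
      ‖∑ n ∈ Finset.range N, ((a n - u n : ℝ) : ℂ) * ∏ j, f j (h n + (j : ℕ) * n)‖ ≤
        2 * (logRate δ N * ∑ n ∈ Finset.range N, u n))
    {X : Type*} [MeasurableSpace X] {μ : Measure X} [IsProbabilityMeasure μ] {T : X → X}
    (hT : MeasurePreserving T μ μ) {F : Fin ℓ → X → ℂ} (hF : ∀ j, Measurable (F j))
    (hF1 : ∀ j x, ‖F j x‖ ≤ 1) :
    ∀ᵐ x ∂μ, Tendsto (fun N => differenceAverage T F a u N x) atTop (𝓝 0) := by
  set w : ℕ → ℝ := fun N => ∑ n ∈ Finset.range N, u n with hwdef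
  set S : ℕ → ℝ := fun N => ∑ n ∈ Finset.range N, a n with hSdef
  set D : ℕ → X → ℂ := fun N x => ∑ n ∈ Finset.range N, (a n - u n) • multipleProduct T F n x
    with hDdef
  have hwpos : ∀ᶠ N in atTop, 0 < w N := hw.eventually_gt_atTop 0
  have hwmono : Monotone w := monotone_nat_of_le_succ fun n => by
    simp only [hwdef, Finset.sum_range_succ]; linarith [hu n]
  have hSmono : Monotone S := monotone_nat_of_le_succ fun n => by
    simp only [hSdef, Finset.sum_range_succ]; linarith [ha n]
  -- Constant functions `f = 1` in the uniform bound show that the actual and expected counts agree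
  -- asymptotically.
  have hSw : Tendsto (fun N => S N / w N) atTop (𝓝 1) := by
    have h0 : Tendsto (fun N => 2 * logRate δ N) atTop (𝓝 0) := by
      simpa using (tendsto_logRate hδ).const_mul 2
    have h1 : Tendsto (fun N => S N / w N - 1) atTop (𝓝 0) := by
      refine squeeze_zero_norm' ?_ h0
      filter_upwards [hshift, hwpos] with N ⟨h, hh⟩ hN
      have := hh (fun _ _ => 1) fun _ _ => by simp
      simp only [Finset.prod_const_one, mul_one] at this
      rw [← Complex.ofReal_sum, Complex.norm_real, Finset.sum_sub_distrib] at this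
      have h2 : S N / w N - 1 = (S N - w N) / w N := by field_simp
      rw [h2, norm_div, Real.norm_of_nonneg hN.le, div_le_iff₀ hN, mul_assoc]
      exact this
    simpa using h1.add_const 1
  have hVw : Tendsto (fun N => (S N + w N) / w N) atTop (𝓝 2) := by
    have h1 : Tendsto (fun N => S N / w N + 1) atTop (𝓝 2) := by
      have := hSw.add_const 1
      norm_num at this
      exact this
    refine h1.congr' ?_
    filter_upwards [hwpos] with N hN
    field_simp
  have hDm : ∀ N, Measurable (D N) := fun N => Finset.measurable_sum _ fun n _ =>
    (measurable_multipleProduct hT.measurable hF n).const_smul (a n - u n)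
  have habs : ∀ n, |a n - u n| ≤ a n + u n := fun n =>
    abs_le.2 ⟨by linarith [ha n, hu n], by linarith [ha n, hu n]⟩
  have hDinc : ∀ x N M, N ≤ M → ‖D M x - D N x‖ ≤ (S M + w M) - (S N + w N) := by
    intro x N M hNM
    have h1 : (S M + w M) - (S N + w N) = ∑ n ∈ Finset.Ico N M, (a n + u n) := by
      simp only [hSdef, hwdef, ← Finset.sum_add_distrib]
      rw [Finset.sum_Ico_eq_sub _ hNM]
    rw [h1]
    simp only [hDdef]
    rw [← Finset.sum_Ico_eq_sub _ hNM]
    refine (norm_sum_le _ _).trans (Finset.sum_le_sum fun n _ => ?_)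
    rw [norm_smul, Real.norm_eq_abs]
    exact (mul_le_of_le_one_right (abs_nonneg _) (norm_multipleProduct_le_one hF1 n x)).trans
      (habs n)
  have hDle : ∀ x N, ‖D N x‖ ≤ S N + w N := fun x N => by
    simpa [hDdef, hSdef, hwdef] using hDinc x 0 N (Nat.zero_le N)
  have hsq : ∀ᶠ N in atTop, ∫ x, (‖D N x‖ / w N) ^ 2 ∂μ ≤ 6 * logRate δ N := by
    filter_upwards [hshift, hwpos, hVw.eventually_le_const (by norm_num : (2 : ℝ) < 3)]
      with N ⟨h, hh⟩ hN hV
    rw [div_le_iff₀ hN] at hV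
    have hsum : ∑ n ∈ Finset.range N, |a n - u n| ≤ 3 * w N := by
      refine le_trans (Finset.sum_le_sum fun n _ => habs n) ?_
      rwa [Finset.sum_add_distrib]
    -- Here `K = 3 w N` and `B = 2 logRate δ N * w N`, whence the factor 6.
    have := integral_norm_sq_le_of_shift hT hh hF hF1 (by linarith : 0 < 3 * w N) hsum
    simp_rw [div_pow]
    rw [integral_div, div_le_iff₀ (by positivity)]
    refine this.trans (le_of_eq ?_)
    ring
  have hlac : ∀ b : ℝ, 1 < b →
      ∀ᵐ x ∂μ, Tendsto (fun k : ℕ => ‖D ⌈b ^ k⌉₊ x‖ / w ⌈b ^ k⌉₊) atTop (𝓝 0) := by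
    intro b hb
    have hmeas : ∀ k : ℕ, Measurable fun x => (‖D ⌈b ^ k⌉₊ x‖ / w ⌈b ^ k⌉₊) ^ 2 := fun k =>
      (((hDm _).norm).div_const _).pow_const 2
    have := ae_tendsto_zero_of_integral_le_summable (μ := μ)
      (f := fun k x => (‖D ⌈b ^ k⌉₊ x‖ / w ⌈b ^ k⌉₊) ^ 2) hmeas (fun _ _ => sq_nonneg _)
      (fun k => Integrable.of_bound (C := ((S ⌈b ^ k⌉₊ + w ⌈b ^ k⌉₊) / |w ⌈b ^ k⌉₊|) ^ 2)
        (hmeas k).aestronglyMeasurable (ae_of_all _ fun x => by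
          rw [norm_pow, norm_div, norm_norm, Real.norm_eq_abs]
          gcongr
          exact hDle x _))
      ((summable_logRate_ceil_pow hδ hb).mul_left 6) ((tendsto_ceil_pow hb).eventually hsq)
    filter_upwards [this] with x hx
    have h1 := hx.sqrt
    simp only [Real.sqrt_zero, Real.sqrt_sq_eq_abs] at h1
    exact (tendsto_zero_iff_abs_tendsto_zero _).2 h1
  -- Countably many ratios `b` suffice, so the exceptional null set does not depend on `ε`.
  have hall : ∀ᵐ x ∂μ, ∀ r : ℕ, Tendsto (fun k : ℕ => ‖D ⌈(1 + 1 / ((r : ℝ) + 1)) ^ k⌉₊ x‖ /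
      w ⌈(1 + 1 / ((r : ℝ) + 1)) ^ k⌉₊) atTop (𝓝 0) :=
    ae_all_iff.2 fun r => hlac _ (lt_add_of_pos_right _ (by positivity))
  filter_upwards [hall] with x hx
  have hDw : Tendsto (fun N => ‖D N x‖ / w N) atTop (𝓝 0) := by
    refine tendsto_zero_of_subseq (V := fun N => S N + w N) (hSmono.add hwmono)
      (fun N M => hDinc x N M) hwmono hwpos hVw fun ε hε => ?_
    -- Consecutive `⌈b^k⌉` differ by a relative amount of at most `2(b - 1)`, so `w` grows by a
    -- factor of at most `1 + 4(b - 1)`; hence `ε / 4`.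
    obtain ⟨r, hr⟩ := exists_nat_one_div_lt (show 0 < ε / 4 by positivity)
    have hb : 1 < 1 + 1 / ((r : ℝ) + 1) := lt_add_of_pos_right _ (by positivity)
    refine ⟨_, monotone_ceil_pow hb, tendsto_ceil_pow hb, ?_, hx r⟩
    filter_upwards [eventually_ceil_pow_succ_sub_le hb, (tendsto_ceil_pow hb).eventually_ge_atTop 2,
      (tendsto_ceil_pow hb).eventually hwpos] with k h1 h2 h3
    refine (sum_range_le_of_antitoneOn hu hmono h2 (monotone_ceil_pow hb k.le_succ) h1).trans ?_
    refine mul_le_mul_of_nonneg_right ?_ h3.le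
    linarith
  rw [tendsto_zero_iff_norm_tendsto_zero]
  have hquot : Tendsto (fun N => ‖D N x‖ / w N / (S N / w N)) atTop (𝓝 0) := by
    have := hDw.div hSw one_ne_zero
    rwa [zero_div] at this
  refine hquot.congr' ?_
  filter_upwards [hwpos] with N hN
  have hS0 : 0 ≤ S N := Finset.sum_nonneg fun n _ => ha n
  rw [div_div_div_cancel_right₀ hN.ne', differenceAverage, norm_smul, norm_inv,
    Real.norm_of_nonneg hS0, div_eq_inv_mul]

lemma differenceAverage_smul {X : Type*} (T : X → X) {ℓ : ℕ} (F : Fin ℓ → X → ℂ) (c : Fin ℓ → ℂ)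
    (a u : ℕ → ℝ) (N : ℕ) (x : X) :
    differenceAverage T (fun j y => c j * F j y) a u N x =
      (∏ j, c j) * differenceAverage T F a u N x := by
  simp only [differenceAverage, multipleProduct, Finset.prod_mul_distrib, Finset.mul_sum,
    Complex.real_smul]
  exact Finset.sum_congr rfl fun n _ => by ring

theorem theoremD {Ω : Type*} [MeasurableSpace Ω] (P : Measure Ω) [IsProbabilityMeasure P]
    (ℓ : ℕ) (hℓ : 1 ≤ ℓ)
    (u : ℕ → ℝ) (U : ℕ → Ω → ℝ) (hU : IsRandomIndicator P u U)
    (hmono : AntitoneOn u (Set.Ici 1))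
    (δ : ℝ) (hδ : 0 < δ)
    (hgrowth : Tendsto
      (fun n : ℕ => u n * ((n : ℝ) ^ ((1 : ℝ) / ((ℓ : ℝ) + 1)) / Real.log (n : ℝ) ^ (2 + δ)))
      atTop atTop) :
    ∀ᵐ ω ∂P, ∀ (X : Type*) [MeasurableSpace X] (μ : Measure X) [IsProbabilityMeasure μ]
      (T : X → X), MeasurePreserving T μ μ →
      ∀ F : Fin ℓ → X → ℂ, (∀ j, Measurable (F j)) → (∀ j, ∃ C : ℝ, ∀ x, ‖F j x‖ ≤ C) →
        ∀ᵐ x ∂μ, Tendsto (fun N : ℕ => differenceAverage T F (fun n => U n ω) u N x)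
          atTop (𝓝 0) := by
  filter_upwards [hU.ae_eventually_exists_shift hℓ hmono hδ hgrowth] with ω hω
  intro X _ μ _ T hT F hF hbd
  choose C hC using hbd
  -- The maximum with 1 keeps the scaling factor invertible even if `C j ≤ 0`.
  let K : Fin ℓ → ℝ := fun j => max (C j) 1
  have hK : ∀ j, 0 < K j := fun j => lt_max_of_lt_right one_pos
  let G : Fin ℓ → X → ℂ := fun j x => (K j : ℂ)⁻¹ * F j x
  have hG1 : ∀ j x, ‖G j x‖ ≤ 1 := fun j x => by
    simp only [G, norm_mul, norm_inv, Complex.norm_real, Real.norm_of_nonneg (hK j).le]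
    rw [inv_mul_le_iff₀ (hK j), mul_one]
    exact (hC j x).trans (le_max_left _ _)
  have hGF : (fun j y => (K j : ℂ) * G j y) = F := by
    ext j y
    have : (K j : ℂ) ≠ 0 := by exact_mod_cast (hK j).ne'
    simp only [G]
    field_simp
  filter_upwards [ae_tendsto_differenceAverage hδ (fun n => hU.nonneg n ω) hU.prob_nonneg hmono
    (tendsto_sum_atTop_of_growth hU.prob_nonneg hmono ℓ hδ hgrowth) hω hT
    (fun j => (hF j).const_mul _) hG1] with x hx
  rw [← hGF]
  simp_rw [differenceAverage_smul]
  simpa using hx.const_mul (∏ j, (K j : ℂ))
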